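/- Let $\mathbf{Loc}$ be the category of locales (the opposite of the category of frames and frame homomorphisms) and let $\Omega \colon \mathbf{Top} \to \mathbf{Loc}$ be the functor sending a space to its frame of open sets. Write $I = [0,1]$ and put $$\mathcal{I}_{\mathbf{Loc}} = \{\Omega(\partial I^n \hookrightarrow I^n)\}_{n \ge 0}, \qquad \mathcal{J}_{\mathbf{Loc}} = \{\Omega(I^n \times \{0\} \hookrightarrow I^n \times I)\}_{n \ge 0}.$$ For a class $\mathcal{W}$ of maps of $\mathbf{Loc}$, let $cell(\mathcal{W})$ be the class of transfinite compositions of pushouts of (small) coproducts of maps in $\mathcal{W}$. Say that a locale $A$ is $\omega$-small relative to a class $\mathcal{D}$ of maps if for every limit ordinal $\lambda > 0$ and every colimit-preserving sequence $X \colon \lambda \to \mathbf{Loc}$ with $X_\beta \to X_{\beta+1}$ in $\mathcal{D}$ for all $\beta < \lambda$, the canonical map $$\operatorname{colim}_{\beta<\lambda} \mathbf{Loc}(A, X_\beta) \to \mathbf{Loc}(A, \operatorname{colim}_{\beta<\lambda} X_\beta)$$ is a bijection. Proposition. For every compact Hausdorff space $K$, the locale $\Omega K$ is $\omega$-small relative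 to $cell(\mathcal{I}_{\mathbf{Loc}})$ and relative to $cell(\mathcal{J}_{\mathbf{Loc}})$. In particular, every map from $\Omega K$ to the colimit of a sequence $X_0 \to X_1 \to \cdots$ of pushouts of coproducts of maps in $\mathcal{I}_{\mathbf{Loc}}$ (or of maps in $\mathcal{J}_{\mathbf{Loc}}$) factors through some $X_n$; and for all $n \ge 0$, $\Omega(\partial I^n)$ is $\omega$-small relative to $cell(\mathcal{I}_{\mathbf{Loc}})$ and $\Omega(I^n)$ is $\omega$-small relative to $cell(\mathcal{J}_{\mathbf{Loc}})$. -/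

import Mathlib

open CategoryTheory

universe w v u

/-- The class `cell(W)` of relative `W`-cell complexes: transfinite compositions of pushouts of
coproducts of maps in `W`. The coproducts and the transfinite compositions are indexed by types in
`Type w`. -/
def cell {C : Type u} [Category.{v} C] (W : MorphismProperty C) : MorphismProperty C :=
  MorphismProperty.transfiniteCompositions.{w} (MorphismProperty.coproducts.{w} W).pushouts

/-- `A` is `ω`-small (also called finite) relative to the class of maps `D`: for every limit
ordinal `λ` (here a well-order `J` in `Type w`, nonempty and without maximum) and every
colimit-preserving `λ`-sequence `F` whose successive maps `F j ⟶ F (j + 1)` lie in `D`, the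
canonical map `colim Hom(A, F j) → Hom(A, colim F)` is a bijection. -/
def IsOmegaSmallRelativeTo {C : Type u} [Category.{v} C] (A : C) (D : MorphismProperty C) : Prop :=
  ∀ (J : Type w) [LinearOrder J] [SuccOrder J] [OrderBot J] [WellFoundedLT J] [NoMaxOrder J]
    (F : J ⥤ C) [F.IsWellOrderContinuous],
    (∀ j : J, D (F.map (homOfLE (Order.le_succ j)))) →
      Limits.PreservesColimit F (coyoneda.obj (Opposite.op A))

/-- A set `S` in a topological space `Y`, with its subspace topology, as an object of
`TopCat.{u}`. -/
abbrev subspaceTop {Y : Type} [TopologicalSpace Y] (S : Set Y) : TopCat.{u} :=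
  TopCat.of (ULift.{u} S)

/-- The inclusion of a subspace `S` of `Y` into `Y`. -/
def subspaceIncl {Y : Type} [TopologicalSpace Y] (S : Set Y) :
    subspaceTop.{u} S ⟶ TopCat.of (ULift.{u} Y) :=
  TopCat.ofHom
    { toFun := fun x => ULift.up x.down.1
      continuous_toFun :=
        continuous_uliftUp.comp (continuous_subtype_val.comp continuous_uliftDown) }

/-- The cube `I^n`. -/
abbrev cubeTop (n : ℕ) : TopCat.{u} := TopCat.of (ULift.{u} (Fin n → unitInterval))

/-- The boundary `∂I^n`: points of the cube with some coordinate equal to `0` or `1`. -/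
abbrev cubeBoundaryTop (n : ℕ) : TopCat.{u} := subspaceTop.{u} (Cube.boundary (Fin n))

/-- The inclusion `i_n : ∂I^n ⟶ I^n`. -/
def cubeBoundaryIncl (n : ℕ) : cubeBoundaryTop.{u} n ⟶ cubeTop.{u} n :=
  subspaceIncl (Cube.boundary (Fin n))

/-- The inclusion `j_n : I^n × {0} ⟶ I^n × I`. -/
def cubeBaseIncl (n : ℕ) :
    subspaceTop.{u} {p : (Fin n → unitInterval) × unitInterval | p.2 = 0} ⟶
      TopCat.of (ULift.{u} ((Fin n → unitInterval) × unitInterval)) :=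
  subspaceIncl {p : (Fin n → unitInterval) × unitInterval | p.2 = 0}

/-- The class `{Ω i_n : Ω ∂I^n ⟶ Ω I^n | n ≥ 0}` of maps of locales. -/
def locI : MorphismProperty Locale.{u} :=
  MorphismProperty.ofHoms fun n : ℕ => topToLocale.map (cubeBoundaryIncl.{u} n)

/-- The class `{Ω j_n : Ω (I^n × {0}) ⟶ Ω (I^n × I) | n ≥ 0}` of maps of locales. -/
def locJ : MorphismProperty Locale.{u} :=
  MorphismProperty.ofHoms fun n : ℕ => topToLocale.map (cubeBaseIncl.{u} n)

/-!
Call a map of locales a separated inclusion if pairs of disjoint opens extend along it and opens of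
the target are determined by their preimages up to the exterior of the source. Inclusions of closed
subspaces of cubes are of this kind, and the class is stable under coproducts, pushouts and
transfinite composition, because pairs of disjoint opens of `X` are maps from `X` to a fixed locale
and hence glue along colimits. A map from `K` into the colimit of such inclusions factors through
the stage `X_i` as soon as it pulls the exterior of `X_i` back to `⊥`.

Suppose that a map from a compact space `K` factors through no stage. Then there are stages
`j₀ < j₁ < ⋯`, points `xₙ` of `K` and neighbourhoods `Nₙ` of `X_{jₙ}` such that the image of `xₙ`
lies neither in `Nₙ` nor in the exterior of `X_{jₙ₊₁}`. Gluing opens at the supremum of the `jₙ`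
shows that `⊤` is the union of the opens `V` which are contained in all but finitely many of the
opens `Nₙ ∪ exterior(X_{jₙ₊₁})`. These `V` form a directed cover of the compact space `K`, so `xₙ`
is mapped into `Nₙ ∪ exterior(X_{jₙ₊₁})` for almost all `n`, a contradiction.
-/

namespace LocaleCell

open Limits TopologicalSpace
open Filter (liminf liminf_eq atTop cofinite)

section Frames

lemma map_iInf_of_finite_ne_top {F K L ι : Type*} [CompleteLattice K] [CompleteLattice L]
    [FunLike F K L] [InfTopHomClass F K L] (φ : F) {x : ι → K} (h : {m | x m ≠ ⊤}.Finite) :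
    φ (⨅ m, x m) = ⨅ m, φ (x m) := by
  refine le_antisymm (le_iInf fun m => OrderHomClass.mono φ (iInf_le x m)) ?_
  have hx : h.toFinset.inf x ≤ ⨅ m, x m := le_iInf fun m => by
    by_cases hm : x m = ⊤
    · exact le_top.trans hm.ge
    · exact Finset.inf_le (h.mem_toFinset.2 hm)
  calc ⨅ m, φ (x m) ≤ h.toFinset.inf (φ ∘ x) := Finset.le_inf fun m _ => iInf_le _ m
    _ = φ (h.toFinset.inf x) := (map_finset_inf φ _ _).symm
    _ ≤ φ (⨅ m, x m) := OrderHomClass.mono φ hx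

lemma point_sSup_iff {L : Type*} [CompleteLattice L] (p : FrameHom L Prop) {S : Set L} :
    p (sSup S) ↔ ∃ V ∈ S, p V := by
  simp [map_sSup, Prop.exists_iff]

variable {K L M : Type*} [Order.Frame K] [Order.Frame L] [Order.Frame M]

lemma eventually_map_eq_top_of_liminf_eq_top {ι : Type*} {f : Filter ι} {u : ι → L}
    (h : liminf u f = ⊤) (φ : FrameHom L M) (hM : IsCompactElement (⊤ : M)) :
    ∀ᶠ i in f, φ (u i) = ⊤ := by
  let S : Set L := {a | ∀ᶠ i in f, a ≤ u i}
  have hS : DirectedOn (· ≤ ·) (φ '' S) := by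
    rintro _ ⟨a, ha, rfl⟩ _ ⟨b, hb, rfl⟩
    have hab : a ⊔ b ∈ S := (Filter.Eventually.and ha hb).mono fun i hi => sup_le hi.1 hi.2
    exact ⟨_, ⟨_, hab, rfl⟩, OrderHomClass.mono φ le_sup_left, OrderHomClass.mono φ le_sup_right⟩
  have htop : sSup (φ '' S) = ⊤ := by rw [← map_sSup, ← liminf_eq, h, map_top]
  obtain ⟨_, ⟨a, ha, rfl⟩, hφa⟩ :=
    (CompleteLattice.isCompactElement_iff_le_of_directed_sSup_le M ⊤).1 hM (φ '' S)
      ⟨_, ⊥, .of_forall fun _ => bot_le, rfl⟩ hS htop.ge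
  exact Filter.Eventually.mono ha fun i hi => top_le_iff.1 (hφa.trans (OrderHomClass.mono φ hi))

lemma exists_frameHom_comp_eq (φ : FrameHom K L) (hφ : Function.Surjective φ)
    (ψ : FrameHom K M) (h : ∀ a b, φ a ≤ φ b → ψ a ≤ ψ b) :
    ∃ χ : FrameHom L M, χ.comp φ = ψ := by
  have h_eq {a b : K} (hab : φ a = φ b) : ψ a = ψ b := le_antisymm (h a b hab.le) (h b a hab.ge)
  choose s hs using hφ
  let χ : FrameHom L M :=
    { toFun a := ψ (s a)
      map_inf' a b := by
        rw [← map_inf]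
        exact h_eq (by rw [map_inf, hs, hs, hs])
      map_top' := by
        rw [← map_top ψ]
        exact h_eq (by rw [map_top, hs])
      map_sSup' S := by
        rw [← Function.comp_def ψ s, Set.image_comp, ← map_sSup]
        exact h_eq (by simp [hs, map_sSup, ← Set.image_comp]) }
  exact ⟨χ, FrameHom.ext fun a => h_eq (hs _)⟩

end Frames

section LowerSets

variable {P L : Type*} [Preorder P] [Order.Frame L]

/-- A map from a preorder to a frame is flat if it is monotone and the induced map from the frame
of lower sets preserves finite meets. -/
structure IsFlat (x : P → L) : Prop where
  monotone : Monotone x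
  iSup_eq_top : ⨆ p, x p = ⊤
  inf_le (p q : P) : x p ⊓ x q ≤ ⨆ (r : P) (_ : r ≤ p ∧ r ≤ q), x r

lemma IsFlat.of_disjoint {x : P → L} (hx : Monotone x) (htop : ⨆ p, x p = ⊤)
    (hdisj : ∀ p q, ¬ p ≤ q → ¬ q ≤ p → Disjoint (x p) (x q)) : IsFlat x where
  monotone := hx
  iSup_eq_top := htop
  inf_le p q := by
    by_cases hpq : p ≤ q
    · exact inf_le_left.trans (le_iSup₂_of_le p ⟨le_rfl, hpq⟩ le_rfl)
    by_cases hqp : q ≤ p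
    · exact inf_le_right.trans (le_iSup₂_of_le q ⟨hqp, le_rfl⟩ le_rfl)
    · exact (hdisj p q hpq hqp).eq_bot.trans_le bot_le

/-- The frame homomorphism out of the frame of lower sets which extends a flat map. -/
def lowerSetLift (x : P → L) (hx : IsFlat x) : FrameHom (LowerSet P) L where
  toFun s := ⨆ p ∈ s, x p
  map_inf' s t := by
    apply le_antisymm
    · exact iSup₂_le fun p hp =>
        le_inf (le_iSup₂_of_le p hp.1 le_rfl) (le_iSup₂_of_le p hp.2 le_rfl)
    · simp only [iSup_inf_eq, inf_iSup_eq]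
      refine iSup₂_le fun q hq => iSup₂_le fun p hp => (hx.inf_le _ _).trans ?_
      exact iSup₂_le fun r hr => le_iSup₂_of_le r ⟨s.lower hr.1 hp, t.lower hr.2 hq⟩ le_rfl
  map_top' := by simp [hx.iSup_eq_top]
  map_sSup' S := by
    simp only [LowerSet.mem_sSup_iff, sSup_image, iSup_exists, iSup_and]
    rw [iSup_comm]
    exact iSup_congr fun _ => iSup_comm

lemma lowerSetLift_Iic {x : P → L} (hx : IsFlat x) (p : P) :
    lowerSetLift x hx (LowerSet.Iic p) = x p :=
  le_antisymm (iSup₂_le fun _ hq => hx.monotone hq) (le_iSup₂_of_le p le_rfl le_rfl)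

lemma frameHom_lowerSet_ext {φ ψ : FrameHom (LowerSet P) L}
    (h : ∀ p, φ (LowerSet.Iic p) = ψ (LowerSet.Iic p)) : φ = ψ := by
  ext s
  have hs : s = ⨆ p ∈ s, LowerSet.Iic p := by
    ext q
    simp only [LowerSet.mem_iSup_iff, LowerSet.mem_Iic_iff, SetLike.mem_coe, exists_prop]
    exact ⟨fun hq => ⟨q, hq, le_rfl⟩, fun ⟨p, hp, hqp⟩ => s.lower hqp hp⟩
  rw [hs]
  simp only [map_iSup, h]

end LowerSets

section Locales

variable {X Y Z : Locale.{u}}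

/-- The inverse image map `f^*` of a map of locales. -/
def preimage (f : X ⟶ Y) : FrameHom Y X := Frm.Hom.hom f.unop

/-- The map of locales with a given inverse image map. -/
def ofPreimage (φ : FrameHom Y X) : X ⟶ Y := Quiver.Hom.op (Frm.ofHom φ)

@[simp]
lemma preimage_id_apply (a : X) : preimage (𝟙 X) a = a := rfl

@[simp]
lemma preimage_comp_apply (f : X ⟶ Y) (g : Y ⟶ Z) (c : Z) :
    preimage (f ≫ g) c = preimage f (preimage g c) := rfl

lemma hom_ext {f g : X ⟶ Y} (h : preimage f = preimage g) : f = g :=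
  Quiver.Hom.unop_inj (Frm.hom_ext h)

lemma preimage_mono (f : X ⟶ Y) : Monotone (preimage f) := OrderHomClass.mono (preimage f)

lemma mono_of_preimage_surjective {f : X ⟶ Y} (hf : Function.Surjective (preimage f)) :
    Mono f where
  right_cancellation g h w := hom_ext <| FrameHom.ext fun a => by
    obtain ⟨b, rfl⟩ := hf a
    rw [← preimage_comp_apply, w, preimage_comp_apply]

section LowerSetLocale

variable {P : Type u} [Preorder P]

variable (P) in
/-- The locale whose opens are the lower sets of a preorder `P`. Maps into it are the same as flat
maps out of `P`. -/
def lowerSetLocale : Locale.{u} := Locale.of (LowerSet P)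

/-- The open of `lowerSetLocale P` given by the principal lower set of `p`. -/
def principalOpen (p : P) : lowerSetLocale P := LowerSet.Iic p

/-- The map of locales which a flat map classifies. -/
def ofFlat (x : P → X) (hx : IsFlat x) : X ⟶ lowerSetLocale P :=
  ofPreimage (Y := lowerSetLocale P) (lowerSetLift x hx)

lemma preimage_ofFlat_principalOpen {x : P → X} (hx : IsFlat x) (p : P) :
    preimage (ofFlat x hx) (principalOpen p) = x p :=
  lowerSetLift_Iic hx p

lemma hom_lowerSetLocale_ext {f g : X ⟶ lowerSetLocale P}
    (h : ∀ p, preimage f (principalOpen p) = preimage g (principalOpen p)) : f = g :=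
  hom_ext (frameHom_lowerSet_ext h)

lemma principalOpen_eq_top {p : P} (hp : ∀ q, q ≤ p) : principalOpen p = ⊤ :=
  LowerSet.ext (Set.eq_univ_of_forall hp)

lemma disjoint_principalOpen {p q : P} (h : ∀ r, r ≤ p → ¬ r ≤ q) :
    Disjoint (principalOpen p) (principalOpen q) :=
  disjoint_iff_inf_le.2 fun r hr => h r hr.1 hr.2

/-- The one-point locale. -/
abbrev pointLocale : Locale.{u} := lowerSetLocale PUnit.{u + 1}

def pointLocaleIsTerminal : IsTerminal pointLocale.{u} :=
  IsTerminal.ofUniqueHom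
    (fun _ => ofFlat (fun _ => ⊤) (.of_disjoint monotone_const (by simp) (by simp)))
    fun _ _ => hom_lowerSetLocale_ext fun _ => by
      rw [principalOpen_eq_top fun _ => le_rfl, map_top, map_top]

end LowerSetLocale

section DisjointPairs

/-- The locale whose maps from `X` are the pairs of disjoint opens of `X`: its opens are the lower
sets of the poset with two incomparable elements `inl` and `inr` below a top element. -/
abbrev disjointPairLocale : Locale.{u} :=
  lowerSetLocale (WithTop (PUnit.{u + 1} ⊕ PUnit.{u + 1}))

/-- The first open classified by a map to `disjointPairLocale`. -/
def leftOpen (f : X ⟶ disjointPairLocale.{u}) : X :=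
  preimage f (principalOpen (Sum.inl PUnit.unit : PUnit ⊕ PUnit))

/-- The second open classified by a map to `disjointPairLocale`. -/
def rightOpen (f : X ⟶ disjointPairLocale.{u}) : X :=
  preimage f (principalOpen (Sum.inr PUnit.unit : PUnit ⊕ PUnit))

lemma isFlat_of_disjoint_pair {L : Type*} [Order.Frame L] {a b : L} (h : Disjoint a b) :
    IsFlat (WithTop.recTopCoe ⊤ (Sum.elim (fun _ => a) fun _ => b) :
      WithTop (PUnit.{u + 1} ⊕ PUnit.{u + 1}) → L) := by
  refine .of_disjoint ?_ (top_le_iff.1 (le_iSup_of_le ⊤ le_rfl)) ?_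
  · rintro (_ | _ | _) (_ | _ | _) hpq <;> simp_all [WithTop.none_eq_top, WithTop.some_eq_coe]
  · rintro (_ | _ | _) (_ | _ | _) hpq hqp <;>
      simp_all [WithTop.none_eq_top, WithTop.some_eq_coe, h.symm]

/-- The map classifying a pair of disjoint opens. -/
def ofDisjoint (a b : X) (h : Disjoint a b) : X ⟶ disjointPairLocale :=
  ofFlat _ (isFlat_of_disjoint_pair h)

lemma disjoint_leftOpen_rightOpen (f : X ⟶ disjointPairLocale.{u}) :
    Disjoint (leftOpen f) (rightOpen f) := by
  refine (disjoint_principalOpen ?_).map (preimage f)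
  rintro (_ | _ | _) <;> simp [WithTop.none_eq_top, WithTop.some_eq_coe]

@[simp]
lemma leftOpen_ofDisjoint (a b : X) (h : Disjoint a b) : leftOpen (ofDisjoint a b h) = a :=
  preimage_ofFlat_principalOpen _ _

@[simp]
lemma rightOpen_ofDisjoint (a b : X) (h : Disjoint a b) : rightOpen (ofDisjoint a b h) = b :=
  preimage_ofFlat_principalOpen _ _

@[simp]
lemma leftOpen_comp (f : X ⟶ Y) (g : Y ⟶ disjointPairLocale.{u}) :
    leftOpen (f ≫ g) = preimage f (leftOpen g) := rfl

@[simp]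
lemma rightOpen_comp (f : X ⟶ Y) (g : Y ⟶ disjointPairLocale.{u}) :
    rightOpen (f ≫ g) = preimage f (rightOpen g) := rfl

lemma hom_disjointPairLocale_ext {f g : X ⟶ disjointPairLocale.{u}}
    (hl : leftOpen f = leftOpen g) (hr : rightOpen f = rightOpen g) : f = g := by
  refine hom_lowerSetLocale_ext ?_
  rintro (_ | _ | _)
  · rw [WithTop.none_eq_top, principalOpen_eq_top fun _ => le_top, map_top, map_top]
  · exact hl
  · exact hr

end DisjointPairs

section Colimit

variable {I : Type w} [Category.{v} I] {F : I ⥤ Locale.{u}} {c : Cocone F}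

lemma exists_glue_disjoint (hc : IsColimit c) (a b : ∀ i, F.obj i)
    (hab : ∀ i, Disjoint (a i) (b i))
    (ha : ∀ ⦃i j⦄ (φ : i ⟶ j), preimage (F.map φ) (a j) = a i)
    (hb : ∀ ⦃i j⦄ (φ : i ⟶ j), preimage (F.map φ) (b j) = b i) :
    ∃ a' b' : c.pt, Disjoint a' b' ∧ (∀ i, preimage (c.ι.app i) a' = a i) ∧
      ∀ i, preimage (c.ι.app i) b' = b i := by
  let s : Cocone F :=
    { pt := disjointPairLocale
      ι :=
        { app i := ofDisjoint (a i) (b i) (hab i)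
          naturality i j φ := by
            refine (hom_disjointPairLocale_ext ?_ ?_).trans (Category.comp_id _).symm
            · simp [ha]
            · simp [hb] } }
  refine ⟨leftOpen (hc.desc s), rightOpen (hc.desc s), disjoint_leftOpen_rightOpen _,
    fun i => ?_, fun i => ?_⟩
  · rw [← leftOpen_comp, hc.fac, leftOpen_ofDisjoint]
  · rw [← rightOpen_comp, hc.fac, rightOpen_ofDisjoint]

lemma exists_glue (hc : IsColimit c) (a : ∀ i, F.obj i)
    (ha : ∀ ⦃i j⦄ (φ : i ⟶ j), preimage (F.map φ) (a j) = a i) :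
    ∃ a' : c.pt, ∀ i, preimage (c.ι.app i) a' = a i := by
  obtain ⟨a', -, -, h, -⟩ := exists_glue_disjoint hc a (fun _ => ⊥) (fun _ => disjoint_bot_right)
    ha (fun _ _ _ => map_bot _)
  exact ⟨a', h⟩

lemma eq_of_preimage_ι_eq (hc : IsColimit c) {a b : c.pt}
    (h : ∀ i, preimage (c.ι.app i) a = preimage (c.ι.app i) b) : a = b := by
  have : ofDisjoint a ⊥ disjoint_bot_right = ofDisjoint b ⊥ disjoint_bot_right :=
    hc.hom_ext fun i => hom_disjointPairLocale_ext (by simpa using h i) (by simp)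
  simpa using congrArg leftOpen this

lemma le_of_preimage_ι_le (hc : IsColimit c) {a b : c.pt}
    (h : ∀ i, preimage (c.ι.app i) a ≤ preimage (c.ι.app i) b) : a ≤ b :=
  inf_eq_left.1 (eq_of_preimage_ι_eq hc fun i => by rw [map_inf, inf_eq_left.2 (h i)])

end Colimit

section Pushout

variable {A A' B B' : Locale.{u}} {f : A ⟶ B} {h : A ⟶ A'} {f' : A' ⟶ B'} {t : B ⟶ B'}

lemma exists_glue_disjoint_of_isPushout (sq : IsPushout h f f' t)
    {a₁ a₂ : A'} {b₁ b₂ : B} (ha : Disjoint a₁ a₂) (hb : Disjoint b₁ b₂)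
    (h₁ : preimage h a₁ = preimage f b₁) (h₂ : preimage h a₂ = preimage f b₂) :
    ∃ c₁ c₂ : B', Disjoint c₁ c₂ ∧ (preimage f' c₁ = a₁ ∧ preimage f' c₂ = a₂) ∧
      preimage t c₁ = b₁ ∧ preimage t c₂ = b₂ := by
  have w : h ≫ ofDisjoint a₁ a₂ ha = f ≫ ofDisjoint b₁ b₂ hb :=
    hom_disjointPairLocale_ext (by simpa using h₁) (by simpa using h₂)
  let d := sq.desc _ _ w
  refine ⟨leftOpen d, rightOpen d, disjoint_leftOpen_rightOpen _, ⟨?_, ?_⟩, ?_, ?_⟩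
  · rw [← leftOpen_comp, sq.inl_desc, leftOpen_ofDisjoint]
  · rw [← rightOpen_comp, sq.inl_desc, rightOpen_ofDisjoint]
  · rw [← leftOpen_comp, sq.inr_desc, leftOpen_ofDisjoint]
  · rw [← rightOpen_comp, sq.inr_desc, rightOpen_ofDisjoint]

lemma le_of_preimage_le_of_isPushout (sq : IsPushout h f f' t) {a b : B'}
    (h₁ : preimage f' a ≤ preimage f' b) (h₂ : preimage t a ≤ preimage t b) : a ≤ b := by
  have : ofDisjoint (a ⊓ b) ⊥ disjoint_bot_right = ofDisjoint a ⊥ disjoint_bot_right :=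
    sq.hom_ext (hom_disjointPairLocale_ext (by simpa using h₁) (by simp))
      (hom_disjointPairLocale_ext (by simpa using h₂) (by simp))
  exact inf_eq_left.1 (by simpa using congrArg leftOpen this)

end Pushout

section ExtendsDisjoint

/-- The maps along which pairs of disjoint opens extend to pairs of disjoint opens. For the
inclusion of a closed subspace, this is the extension property of completely normal spaces. -/
def extendsDisjoint : MorphismProperty Locale.{u} := fun A B f =>
  ∀ a₁ a₂ : A, Disjoint a₁ a₂ →
    ∃ b₁ b₂ : B, Disjoint b₁ b₂ ∧ preimage f b₁ = a₁ ∧ preimage f b₂ = a₂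

-- Classes defined by a left lifting property have all the stability properties needed below.
lemma extendsDisjoint_eq_llp :
    extendsDisjoint.{u} = (MorphismProperty.ofHoms fun _ : PUnit.{1} =>
      pointLocaleIsTerminal.from disjointPairLocale.{u}).llp := by
  ext A B f
  rw [MorphismProperty.llp_ofHoms_iff_hasLiftingProperty]
  constructor
  · intro hf
    refine ⟨fun {g _} sq => ?_⟩
    obtain ⟨b₁, b₂, hb, h₁, h₂⟩ := hf _ _ (disjoint_leftOpen_rightOpen g)
    exact ⟨⟨⟨ofDisjoint b₁ b₂ hb,
      hom_disjointPairLocale_ext (by simpa using h₁) (by simpa using h₂),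
      pointLocaleIsTerminal.hom_ext _ _⟩⟩⟩
  · intro hf a₁ a₂ ha
    have sq : CommSq (ofDisjoint a₁ a₂ ha) f (pointLocaleIsTerminal.from disjointPairLocale)
      (pointLocaleIsTerminal.from B) := ⟨pointLocaleIsTerminal.hom_ext _ _⟩
    refine ⟨leftOpen sq.lift, rightOpen sq.lift, disjoint_leftOpen_rightOpen _, ?_, ?_⟩
    · rw [← leftOpen_comp, sq.fac_left, leftOpen_ofDisjoint]
    · rw [← rightOpen_comp, sq.fac_left, rightOpen_ofDisjoint]

instance : extendsDisjoint.{u}.IsStableUnderCobaseChange := by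
  rw [extendsDisjoint_eq_llp]; infer_instance

instance : MorphismProperty.IsStableUnderCoproducts.{w} extendsDisjoint.{u} := by
  rw [extendsDisjoint_eq_llp]; infer_instance

instance : MorphismProperty.IsStableUnderTransfiniteComposition.{w} extendsDisjoint.{u} := by
  rw [extendsDisjoint_eq_llp]; infer_instance

instance : extendsDisjoint.{u}.IsMultiplicative := by
  rw [extendsDisjoint_eq_llp]; infer_instance

lemma extendsDisjoint.preimage_surjective {f : X ⟶ Y} (hf : extendsDisjoint f) :
    Function.Surjective (preimage f) := fun a =>
  let ⟨b, _, _, h, _⟩ := hf a ⊥ disjoint_bot_right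
  ⟨b, h⟩

end ExtendsDisjoint

section Exterior

/-- The exterior of a map `f` of locales: the union of the opens of `Y` which are disjoint from
some open neighbourhood of the image of `f`. -/
def exterior (f : X ⟶ Y) : Y := sSup {b | ∃ b' : Y, Disjoint b b' ∧ preimage f b' = ⊤}

lemma le_exterior {f : X ⟶ Y} {b b' : Y} (h : Disjoint b b') (h' : preimage f b' = ⊤) :
    b ≤ exterior f :=
  le_sSup ⟨b', h, h'⟩

lemma exterior_le {f : X ⟶ Y} {c : Y}
    (h : ∀ b b' : Y, Disjoint b b' → preimage f b' = ⊤ → b ≤ c) : exterior f ≤ c :=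
  sSup_le fun b ⟨b', hb, hb'⟩ => h b b' hb hb'

lemma preimage_eq_bot_of_disjoint {f : X ⟶ Y} {b b' : Y} (h : Disjoint b b')
    (h' : preimage f b' = ⊤) : preimage f b = ⊥ :=
  disjoint_top.1 (h' ▸ h.map (preimage f))

lemma exterior_comp_le (f : X ⟶ Y) (g : Y ⟶ Z) : exterior g ≤ exterior (f ≫ g) :=
  exterior_le fun _ _ h h' => le_exterior h (by rw [preimage_comp_apply, h', map_top])

lemma exterior_le_preimage_exterior {A B A' B' : Locale.{u}} {f : A ⟶ B} {f' : A' ⟶ B'}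
    {t : B ⟶ B'} (h : ∀ b₁ b₂ : B, Disjoint b₁ b₂ → preimage f b₂ = ⊤ →
      ∃ c₁ c₂ : B', Disjoint c₁ c₂ ∧ preimage f' c₂ = ⊤ ∧ preimage t c₁ = b₁) :
    exterior f ≤ preimage t (exterior f') :=
  exterior_le fun b₁ b₂ hb hb₂ => by
    obtain ⟨c₁, c₂, hc, hc₂, rfl⟩ := h b₁ b₂ hb hb₂
    exact preimage_mono t (le_exterior hc hc₂)

lemma exterior_le_preimage_exterior_comp (f : X ⟶ Y) {g : Y ⟶ Z} (hg : extendsDisjoint g) :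
    exterior f ≤ preimage g (exterior (f ≫ g)) :=
  exterior_le_preimage_exterior fun b₁ b₂ hb hb₂ => by
    obtain ⟨c₁, c₂, hc, h₁, rfl⟩ := hg b₁ b₂ hb
    exact ⟨c₁, c₂, hc, hb₂, h₁⟩

lemma exterior_le_preimage_exterior_of_isPushout {A A' B B' : Locale.{u}} {f : A ⟶ B}
    {h : A ⟶ A'} {f' : A' ⟶ B'} {t : B ⟶ B'} (sq : IsPushout h f f' t) :
    exterior f ≤ preimage t (exterior f') :=
  exterior_le_preimage_exterior fun b₁ b₂ hb hb₂ => by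
    obtain ⟨c₁, c₂, hc, ⟨-, h₂⟩, h₁, -⟩ := exists_glue_disjoint_of_isPushout sq
      (disjoint_bot_left (a := (⊤ : A'))) hb
      (by rw [map_bot, preimage_eq_bot_of_disjoint hb hb₂]) (by rw [map_top, hb₂])
    exact ⟨c₁, c₂, hc, h₂, h₁⟩

lemma exists_disjoint_preimage_ι_eq_update {I : Type w} [DecidableEq I]
    {F : Discrete I ⥤ Locale.{u}} {c : Cocone F} (hc : IsColimit c) (i : Discrete I)
    {a b : F.obj i} (hab : Disjoint a b) :
    ∃ a' b' : c.pt, Disjoint a' b' ∧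
      (∀ k, preimage (c.ι.app k) a' = Function.update (fun k => (⊥ : F.obj k)) i a k) ∧
      ∀ k, preimage (c.ι.app k) b' = Function.update (fun k => (⊤ : F.obj k)) i b k := by
  have compat (x : ∀ k, F.obj k) ⦃k l : Discrete I⦄ (ψ : k ⟶ l) :
      preimage (F.map ψ) (x l) = x k := by
    obtain rfl : k = l := Discrete.ext (Discrete.eq_of_hom ψ)
    rw [Discrete.functor_map_id, preimage_id_apply]
  refine exists_glue_disjoint hc _ _ (fun k => ?_) (compat _) (compat _)
  obtain rfl | hk := eq_or_ne k i
  · simpa using hab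
  · simp [hk]

lemma exterior_le_preimage_exterior_of_isColimit {I : Type w} {F G : Discrete I ⥤ Locale.{u}}
    {c₁ : Cocone F} {c₂ : Cocone G} (h₁ : IsColimit c₁) (h₂ : IsColimit c₂) (α : F ⟶ G)
    (φ : c₁.pt ⟶ c₂.pt) (hφ : ∀ i, c₁.ι.app i ≫ φ = α.app i ≫ c₂.ι.app i) (i : Discrete I) :
    exterior (α.app i) ≤ preimage (c₂.ι.app i) (exterior φ) := by
  classical
  refine exterior_le_preimage_exterior fun b₁ b₂ hb hb₂ => ?_
  obtain ⟨b₁', b₂', hb', h₁', h₂'⟩ := exists_disjoint_preimage_ι_eq_update h₂ i hb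
  refine ⟨b₁', b₂', hb', eq_of_preimage_ι_eq h₁ fun k => ?_, by rw [h₁', Function.update_self]⟩
  rw [← preimage_comp_apply, hφ, preimage_comp_apply, h₂', map_top]
  obtain rfl | hk := eq_or_ne k i
  · rw [Function.update_self, hb₂]
  · rw [Function.update_of_ne hk, map_top]

end Exterior

section IsSeparatedInclusion

/-- Separated inclusions are the localic counterpart of closed embeddings into spaces which are
regular and completely normal: disjoint opens extend along `f`, and an open of `Y` is determined up
to the exterior of `f` by its preimage. -/
structure IsSeparatedInclusion (f : X ⟶ Y) : Prop where
  extendsDisjoint : extendsDisjoint f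
  le_sup_exterior ⦃b b' : Y⦄ : preimage f b ≤ preimage f b' → b ≤ b' ⊔ exterior f

/-- The class of separated inclusions of locales. -/
def separatedInclusions : MorphismProperty Locale.{u} := fun _ _ f => IsSeparatedInclusion f

namespace IsSeparatedInclusion

lemma comp {f : X ⟶ Y} {g : Y ⟶ Z} (hf : IsSeparatedInclusion f) (hg : IsSeparatedInclusion g) :
    IsSeparatedInclusion (f ≫ g) where
  extendsDisjoint := MorphismProperty.comp_mem _ _ _ hf.extendsDisjoint hg.extendsDisjoint
  le_sup_exterior c c' h := by
    have hgc : preimage g c ≤ preimage g (c' ⊔ exterior (f ≫ g)) := by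
      rw [map_sup]
      exact (hf.le_sup_exterior h).trans
        (sup_le_sup_left (exterior_le_preimage_exterior_comp f hg.extendsDisjoint) _)
    calc c ≤ c' ⊔ exterior (f ≫ g) ⊔ exterior g := hg.le_sup_exterior hgc
      _ = c' ⊔ exterior (f ≫ g) := sup_of_le_left ((exterior_comp_le f g).trans le_sup_right)

lemma of_isIso (f : X ⟶ Y) [IsIso f] : IsSeparatedInclusion f where
  extendsDisjoint := MorphismProperty.of_isIso _ f
  le_sup_exterior b b' h := by
    refine le_sup_of_le_left ?_
    simpa [← preimage_comp_apply] using preimage_mono (inv f) h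

lemma of_isPushout {A A' B B' : Locale.{u}} {f : A ⟶ B} {h : A ⟶ A'} {f' : A' ⟶ B'}
    {t : B ⟶ B'} (sq : IsPushout h f f' t) (hf : IsSeparatedInclusion f) :
    IsSeparatedInclusion f' where
  extendsDisjoint := MorphismProperty.of_isPushout sq hf.extendsDisjoint
  le_sup_exterior b b' hb := by
    have hfb : preimage f (preimage t b) ≤ preimage f (preimage t b') := by
      rw [← preimage_comp_apply, ← preimage_comp_apply, ← sq.w]
      exact preimage_mono h hb
    refine le_of_preimage_le_of_isPushout sq (hb.trans (preimage_mono _ le_sup_left)) ?_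
    rw [map_sup]
    exact (hf.le_sup_exterior hfb).trans
      (sup_le_sup_left (exterior_le_preimage_exterior_of_isPushout sq) _)

lemma of_isColimit_discrete {I : Type w} {F G : Discrete I ⥤ Locale.{u}} {c₁ : Cocone F}
    {c₂ : Cocone G} (h₁ : IsColimit c₁) (h₂ : IsColimit c₂) (α : F ⟶ G)
    (hα : ∀ i, IsSeparatedInclusion (α.app i)) (φ : c₁.pt ⟶ c₂.pt)
    (hφ : ∀ i, c₁.ι.app i ≫ φ = α.app i ≫ c₂.ι.app i) : IsSeparatedInclusion φ where
  extendsDisjoint := MorphismProperty.IsStableUnderColimitsOfShape.condition _ _ _ _ h₁ h₂ α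
    (fun i => (hα i).extendsDisjoint) φ hφ
  le_sup_exterior b b' hb := le_of_preimage_ι_le h₂ fun i => by
    have hαb : preimage (α.app i) (preimage (c₂.ι.app i) b) ≤
        preimage (α.app i) (preimage (c₂.ι.app i) b') := by
      rw [← preimage_comp_apply, ← preimage_comp_apply, ← hφ]
      exact preimage_mono (c₁.ι.app i) hb
    rw [map_sup]
    exact ((hα i).le_sup_exterior hαb).trans
      (sup_le_sup_left (exterior_le_preimage_exterior_of_isColimit h₁ h₂ α φ hφ i) _)

lemma of_isColimit {J : Type w} [Preorder J] [OrderBot J] {F : J ⥤ Locale.{u}}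
    {c : Cocone F} (hc : IsColimit c)
    (hF : ∀ j, IsSeparatedInclusion (F.map (homOfLE (bot_le : ⊥ ≤ j))))
    (hι : ∀ j, LocaleCell.extendsDisjoint (c.ι.app j)) :
    IsSeparatedInclusion (c.ι.app ⊥) where
  extendsDisjoint := hι ⊥
  le_sup_exterior b b' h := le_of_preimage_ι_le hc fun j => by
    rw [← c.w (homOfLE (bot_le : ⊥ ≤ j))] at h ⊢
    rw [map_sup]
    exact ((hF j).le_sup_exterior h).trans
      (sup_le_sup_left (exterior_le_preimage_exterior_comp _ (hι j)) _)

end IsSeparatedInclusion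

instance : separatedInclusions.{u}.IsMultiplicative where
  id_mem A := .of_isIso (𝟙 A)
  comp_mem _ _ hf hg := hf.comp hg

instance : separatedInclusions.{u}.RespectsIso :=
  MorphismProperty.respectsIso_of_isStableUnderComposition fun _ _ f (_ : IsIso f) => .of_isIso f

instance : separatedInclusions.{u}.IsStableUnderCobaseChange where
  of_isPushout := .of_isPushout

instance : MorphismProperty.IsStableUnderCoproducts.{w} separatedInclusions.{u} where
  isStableUnderCoproductsOfShape _ :=
    { condition _ _ _ _ h₁ h₂ α hα φ hφ := .of_isColimit_discrete h₁ h₂ α hα φ hφ }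

lemma isSeparatedInclusion_map_bot {J : Type w} [LinearOrder J] [SuccOrder J] [OrderBot J]
    [WellFoundedLT J] {X Y : Locale.{u}} {f : X ⟶ Y}
    (h : separatedInclusions.TransfiniteCompositionOfShape J f) (j : J) :
    IsSeparatedInclusion (h.F.map (homOfLE (bot_le : ⊥ ≤ j))) := by
  induction j using SuccOrder.limitRecOn with
  | isMin j hj =>
    obtain rfl := hj.eq_bot
    rw [Subsingleton.elim (homOfLE bot_le) (𝟙 ⊥), h.F.map_id]
    exact .of_isIso _
  | succ j hj hj' =>
    rw [← homOfLE_comp bot_le (Order.le_succ j), h.F.map_comp]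
    exact hj'.comp (h.map_mem j hj)
  | isSuccLimit j hj hj' =>
    let : OrderBot (Set.Iio j) :=
      { bot := ⟨⊥, Order.IsSuccLimit.bot_lt hj⟩
        bot_le _ := bot_le }
    let h' := h.ofLE (W' := extendsDisjoint) fun _ _ _ hf => hf.extendsDisjoint
    exact .of_isColimit (h.F.isColimitOfIsWellOrderContinuous j hj) (fun k => hj' k.1 k.2)
      fun k => h'.mem_map _

instance : MorphismProperty.IsStableUnderTransfiniteComposition.{w} separatedInclusions.{u} where
  isStableUnderTransfiniteCompositionOfShape J := by
    intros
    refine ⟨fun X Y f ⟨h⟩ => ?_⟩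
    let h' := h.ofLE (W' := extendsDisjoint) fun _ _ _ hf => hf.extendsDisjoint
    have hbot : IsSeparatedInclusion (h.incl.app ⊥) :=
      .of_isColimit h.isColimit (isSeparatedInclusion_map_bot h) h'.mem_incl_app
    exact (separatedInclusions.arrow_mk_iso_iff (Arrow.isoMk h.isoBot.symm (Iso.refl _))).2 hbot

end IsSeparatedInclusion

section Spaces

lemma exists_disjoint_comap_eq {X Y : Type*} [TopologicalSpace X] [TopologicalSpace Y]
    [CompletelyNormalSpace Y] {f : C(X, Y)} (hf : Topology.IsInducing f) {a₁ a₂ : Opens X}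
    (ha : Disjoint a₁ a₂) :
    ∃ b₁ b₂ : Opens Y, Disjoint b₁ b₂ ∧ b₁.comap f = a₁ ∧ b₂.comap f = a₂ := by
  have disjoint_closure_image {a b : Opens X} (hab : Disjoint a b) :
      Disjoint (closure (f '' a)) (f '' b) := by
    have hcl := (Opens.coe_disjoint.2 hab).closure_left b.2
    rw [hf.closure_eq_preimage_closure_image] at hcl
    exact Set.disjoint_image_right.2 hcl
  obtain ⟨u₁, u₂, hu₁, hu₂, hau₁, hau₂, hu⟩ := separatedNhds_iff_disjoint.2
    (CompletelyNormalSpace.completely_normal (disjoint_closure_image ha)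
      (disjoint_closure_image ha.symm).symm)
  have exists_comap_eq (a : Opens X) : ∃ v : Opens Y, v.comap f = a := by
    obtain ⟨v, hv, h⟩ := hf.isOpen_iff.1 a.2
    exact ⟨⟨v, hv⟩, Opens.ext h⟩
  obtain ⟨v₁, rfl⟩ := exists_comap_eq a₁
  obtain ⟨v₂, rfl⟩ := exists_comap_eq a₂
  refine ⟨⟨u₁, hu₁⟩ ⊓ v₁, ⟨u₂, hu₂⟩ ⊓ v₂, ?_, ?_, ?_⟩
  · exact Opens.coe_disjoint.1 (hu.mono Set.inter_subset_left Set.inter_subset_left)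
  · exact Opens.ext (Set.inter_eq_right.2 (Set.image_subset_iff.1 hau₁))
  · exact Opens.ext (Set.inter_eq_right.2 (Set.image_subset_iff.1 hau₂))

lemma isSeparatedInclusion_topToLocale_map {X Y : TopCat.{u}} [CompletelyNormalSpace Y]
    [RegularSpace Y] {f : X ⟶ Y} (hf : Topology.IsInducing f) (hrange : IsClosed (Set.range f)) :
    IsSeparatedInclusion (topToLocale.map f) where
  extendsDisjoint _ _ ha := exists_disjoint_comap_eq (f := f.hom) hf ha
  le_sup_exterior := fun (b b' : Opens Y) h y hy => by
    by_cases hyf : y ∈ Set.range f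
    · obtain ⟨x, rfl⟩ := hyf
      exact Or.inl (h hy)
    · have hsep : SeparatedNhds {y} (Set.range f) := by
        rw [separatedNhds_iff_disjoint, nhdsSet_singleton]
        exact (RegularSpace.regular hrange hyf).symm
      obtain ⟨u, v, hu, hv, hyu, hfv, huv⟩ := hsep
      have hdisj : Disjoint (⟨u, hu⟩ : Opens Y) ⟨v, hv⟩ := Opens.coe_disjoint.1 huv
      have htop : Opens.comap f.hom ⟨v, hv⟩ = ⊤ := top_le_iff.1 fun x _ => hfv ⟨x, rfl⟩
      exact Or.inr (le_exterior (f := topToLocale.map f) hdisj htop (hyu rfl))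

lemma isClosedEmbedding_subspaceIncl {Y : Type} [TopologicalSpace Y] {S : Set Y}
    (hS : IsClosed S) : Topology.IsClosedEmbedding (subspaceIncl.{u} S) :=
  (Homeomorph.ulift.symm.isClosedEmbedding.comp hS.isClosedEmbedding_subtypeVal).comp
    Homeomorph.ulift.isClosedEmbedding

lemma isSeparatedInclusion_subspaceIncl {Y : Type} [TopologicalSpace Y] [T5Space Y] {S : Set Y}
    (hS : IsClosed S) : IsSeparatedInclusion (topToLocale.map (subspaceIncl.{u} S)) :=
  have h := isClosedEmbedding_subspaceIncl hS
  isSeparatedInclusion_topToLocale_map h.isInducing h.isClosed_range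

lemma isClosed_cubeBoundary (n : ℕ) : IsClosed (Cube.boundary (Fin n)) := by
  have h : Cube.boundary (Fin n) = ⋃ i, {y | y i = 0 ∨ y i = 1} := by
    ext y
    simp [Cube.boundary]
  rw [h]
  exact isClosed_iUnion_of_finite fun i =>
    (isClosed_eq (continuous_apply i) continuous_const).union
      (isClosed_eq (continuous_apply i) continuous_const)

instance (n : ℕ) : CompactSpace (Cube.boundary (Fin n)) :=
  isCompact_iff_compactSpace.1 (isClosed_cubeBoundary n).isCompact

lemma locI_le_separatedInclusions : locI.{u} ≤ separatedInclusions := by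
  rintro _ _ _ ⟨n⟩
  exact isSeparatedInclusion_subspaceIncl (isClosed_cubeBoundary n)

lemma locJ_le_separatedInclusions : locJ.{u} ≤ separatedInclusions := by
  rintro _ _ _ ⟨n⟩
  exact isSeparatedInclusion_subspaceIncl (isClosed_eq continuous_snd continuous_const)

end Spaces

lemma cell_le {C : Type u} [Category.{v} C] {W D : MorphismProperty C}
    [D.IsStableUnderCobaseChange] [MorphismProperty.IsStableUnderCoproducts.{w} D]
    [MorphismProperty.IsStableUnderTransfiniteComposition.{w} D] (h : W ≤ D) :
    cell.{w} W ≤ D := by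
  simpa [cell] using h

section Liminf

lemma liminf_cofinite_eq_top {I : Type w} [Category.{v} I] {F : I ⥤ Locale.{u}} {c : Cocone F}
    (hc : IsColimit c) {ι : Type*} {N : ι → c.pt}
    (hN : ∀ i, ∀ᶠ m in cofinite, preimage (c.ι.app i) (N m) = ⊤) : liminf N cofinite = ⊤ := by
  refine top_le_iff.1 (le_of_preimage_ι_le hc fun i => ?_)
  -- On each stage, all but finitely many of the `N m` restrict to `⊤`, so the intersection of those
  -- with `ι_i^* (N m) = ⊤` is preserved by the transition maps.
  let S := {m // preimage (c.ι.app i) (N m) = ⊤}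
  obtain ⟨V, hV⟩ := exists_glue hc (fun k => ⨅ m : S, preimage (c.ι.app k) (N m))
    fun k l φ => by
      rw [map_iInf_of_finite_ne_top]
      · simp only [← preimage_comp_apply, c.w]
      · exact Set.Finite.preimage Subtype.val_injective.injOn (Filter.eventually_cofinite.1 (hN l))
  have hVN (m : S) : V ≤ N m := le_of_preimage_ι_le hc fun k => (hV k).trans_le (iInf_le _ m)
  have hV_liminf : V ≤ liminf N cofinite := by
    rw [liminf_eq]
    exact le_sSup ((hN i).mono fun m hm => hVN ⟨m, hm⟩)
  have hV_top : preimage (c.ι.app i) V = ⊤ := (hV i).trans (iInf_eq_top.2 fun m => m.2)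
  rw [map_top, ← hV_top]
  exact preimage_mono _ hV_liminf

lemma IsSeparatedInclusion.liminf_sup_exterior_eq_top {f : X ⟶ Y} (hf : IsSeparatedInclusion f)
    {ι : Type*} {l : Filter ι} {N : ι → Y} (h : liminf (fun n => preimage f (N n)) l = ⊤) :
    liminf (fun n => N n ⊔ exterior f) l = ⊤ := by
  have h_ext : exterior f ≤ liminf (fun n => N n ⊔ exterior f) l := by
    rw [liminf_eq]
    exact le_sSup (.of_forall fun n => le_sup_right)
  have h_top : preimage f ⊤ ≤ preimage f (liminf (fun n => N n ⊔ exterior f) l) := by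
    rw [map_top, ← h, liminf_eq]
    refine sSup_le fun a ha => ?_
    obtain ⟨b, rfl⟩ := hf.extendsDisjoint.preimage_surjective a
    refine preimage_mono f ?_
    rw [liminf_eq]
    exact le_sSup (Filter.Eventually.mono ha fun n hn => hf.le_sup_exterior hn)
  exact top_le_iff.1 ((hf.le_sup_exterior h_top).trans (sup_le le_rfl h_ext))

section Preorder

variable {J : Type w} [Preorder J] {F : J ⥤ Locale.{u}} {c : Cocone F}

lemma preimage_ι_eq_top_of_le {i j : J} (hij : i ≤ j) {V : c.pt}
    (h : preimage (c.ι.app j) V = ⊤) : preimage (c.ι.app i) V = ⊤ := by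
  rw [← c.w (homOfLE hij), preimage_comp_apply, h, map_top]

lemma exterior_ι_antitone : Antitone fun j => (exterior (c.ι.app j) : c.pt) := fun i j hij => by
  dsimp only
  rw [← c.w (homOfLE hij)]
  exact exterior_comp_le _ _

lemma liminf_eq_top_of_cofinal (hc : IsColimit c) {j : ℕ → J} (hj : Monotone j)
    (hcof : ∀ i, ∃ n, i ≤ j n) {N : ℕ → c.pt} (hN : ∀ n, preimage (c.ι.app (j n)) (N n) = ⊤) :
    liminf N atTop = ⊤ := by
  rw [← Nat.cofinite_eq_atTop]
  refine liminf_cofinite_eq_top hc fun i => ?_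
  obtain ⟨n, hn⟩ := hcof i
  rw [Nat.cofinite_eq_atTop]
  filter_upwards [Filter.eventually_ge_atTop n] with m hm
  exact preimage_ι_eq_top_of_le (hn.trans (hj hm)) (hN m)

end Preorder

lemma isSuccLimit_or_cofinal {J : Type*} [LinearOrder J] [WellFoundedLT J] {j : ℕ → J}
    (hj : StrictMono j) :
    (∀ i, ∃ n, i ≤ j n) ∨
      ∃ l, Order.IsSuccLimit l ∧ (∀ n, j n < l) ∧ ∀ i < l, ∃ n, i ≤ j n := by
  by_cases hbdd : BddAbove (Set.range j)
  · right
    obtain ⟨l, hl, hmin⟩ := WellFounded.has_min (wellFounded_lt (α := J)) _ hbdd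
    have hlub : IsLUB (Set.range j) l := ⟨hl, fun i hi => not_lt.1 (hmin i hi)⟩
    have hlt (n : ℕ) : j n < l := (hj n.lt_succ_self).trans_le (hl ⟨n + 1, rfl⟩)
    refine ⟨l, hlub.isSuccLimit_of_notMem (Set.range_nonempty j) ?_, hlt, fun i hi => ?_⟩
    · rintro ⟨n, hn⟩
      exact (hlt n).ne hn
    · obtain ⟨_, ⟨n, rfl⟩, hn⟩ := (lt_isLUB_iff hlub).1 hi
      exact ⟨n, hn.le⟩
  · refine Or.inl fun i => ?_
    obtain ⟨_, ⟨n, rfl⟩, hn⟩ := not_bddAbove_iff.1 hbdd i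
    exact ⟨n, hn.le⟩

section WellOrder

variable {J : Type w} [LinearOrder J] [WellFoundedLT J] {F : J ⥤ Locale.{u}}
  [F.IsWellOrderContinuous] {c : Cocone F}

lemma liminf_sup_exterior_ι_eq_top (hc : IsColimit c)
    (hι : ∀ i, IsSeparatedInclusion (c.ι.app i)) {j : ℕ → J} (hj : StrictMono j) {N : ℕ → c.pt}
    (hN : ∀ n, preimage (c.ι.app (j n)) (N n) = ⊤) :
    liminf (fun n => N n ⊔ exterior (c.ι.app (j (n + 1)))) atTop = ⊤ := by
  suffices ∃ M : ℕ → c.pt, liminf M atTop = ⊤ ∧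
      ∀ n, M n ≤ N n ⊔ exterior (c.ι.app (j (n + 1))) by
    obtain ⟨M, hM, hMN⟩ := this
    exact top_le_iff.1 (hM ▸ Filter.liminf_le_liminf (.of_forall hMN))
  obtain hcof | ⟨l, hlim, hlt, hcof⟩ := isSuccLimit_or_cofinal hj
  · exact ⟨N, liminf_eq_top_of_cofinal hc hj.monotone hcof hN, fun n => le_sup_left⟩
  · have hNl (n : ℕ) : preimage (F.map (homOfLE (hlt n).le)) (preimage (c.ι.app l) (N n)) = ⊤ := by
      rw [← preimage_comp_apply, c.w, hN]
    have hstage : liminf (fun n => preimage (c.ι.app l) (N n)) atTop = ⊤ :=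
      liminf_eq_top_of_cofinal (F.isColimitOfIsWellOrderContinuous l hlim)
        (j := fun n => ⟨j n, hlt n⟩) hj.monotone (fun i => hcof i.1 i.2) hNl
    exact ⟨_, (hι l).liminf_sup_exterior_eq_top hstage,
      fun n => sup_le_sup_left (exterior_ι_antitone (hlt (n + 1)).le) _⟩

end WellOrder

end Liminf

section Compact

lemma exists_not_exterior {I : Type w} [Category.{v} I] {F : I ⥤ Locale.{u}} {c : Cocone F}
    (hc : IsColimit c) (p : FrameHom c.pt Prop) : ∃ i, ¬ p (exterior (c.ι.app i)) := by
  by_contra! h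
  -- `V` is the complement of the closure of the point `p`.
  let V : c.pt := sSup {b | ¬ p b}
  have hpV : ¬ p V := fun hp => by
    obtain ⟨b, hb, hpb⟩ := (point_sSup_iff p).1 hp
    exact hb hpb
  have hV : V = ⊤ := eq_of_preimage_ι_eq hc fun i => by
    obtain ⟨b, ⟨b', hbb', hb'⟩, hpb⟩ := (point_sSup_iff p).1 (h i)
    have hpb' : ¬ p b' := fun hpb' => disjoint_iff_inf_le.1 (hbb'.map p) ⟨hpb, hpb'⟩
    rw [map_top, ← top_le_iff, ← hb']
    exact preimage_mono _ (le_sSup hpb')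
  rw [hV, map_top] at hpV
  exact hpV trivial

variable {J : Type w} [LinearOrder J] {F : J ⥤ Locale.{u}} {c : Cocone F}

lemma exists_not_sup_exterior (hc : IsColimit c) (p : FrameHom c.pt Prop) {i : J}
    (hp : p (exterior (c.ι.app i))) :
    ∃ k > i, ∃ N : c.pt, preimage (c.ι.app i) N = ⊤ ∧ ¬ p (N ⊔ exterior (c.ι.app k)) := by
  obtain ⟨k, hk⟩ := exists_not_exterior hc p
  obtain ⟨b, ⟨N, hbN, hN⟩, hpb⟩ := (point_sSup_iff p).1 hp
  have hpN : ¬ p N := fun hpN => disjoint_iff_inf_le.1 (hbN.map p) ⟨hpb, hpN⟩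
  refine ⟨k, lt_of_not_ge fun hki => hk ?_, N, hN, ?_⟩
  · exact OrderHomClass.mono p (exterior_ι_antitone hki) hp
  · rw [map_sup]
    exact not_or.2 ⟨hpN, hk⟩

variable {K : Type*} [TopologicalSpace K]

lemma exists_map_sup_exterior_ne_top (hc : IsColimit c) (g : FrameHom c.pt (Opens K)) {i : J}
    (hg : g (exterior (c.ι.app i)) ≠ ⊥) :
    ∃ k > i, ∃ N : c.pt, preimage (c.ι.app i) N = ⊤ ∧ g (N ⊔ exterior (c.ι.app k)) ≠ ⊤ := by
  obtain ⟨x, hx⟩ := (Opens.ne_bot_iff_nonempty _).1 hg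
  obtain ⟨k, hik, N, hN, hxN⟩ :=
    exists_not_sup_exterior hc ((Locale.localePointOfSpacePoint K x).comp g) hx
  exact ⟨k, hik, N, hN, fun h => hxN (h.ge trivial)⟩

lemma exists_map_exterior_eq_bot [Nonempty J] [WellFoundedLT J] [F.IsWellOrderContinuous]
    [CompactSpace K] (hc : IsColimit c) (hι : ∀ i, IsSeparatedInclusion (c.ι.app i))
    (g : FrameHom c.pt (Opens K)) : ∃ i, g (exterior (c.ι.app i)) = ⊥ := by
  by_contra! h
  choose next hnext N hN hgN using fun i => exists_map_sup_exterior_ne_top hc g (h i)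
  let j (n : ℕ) : J := next^[n] (Classical.arbitrary J)
  have hj_succ (n : ℕ) : j (n + 1) = next (j n) := Function.iterate_succ_apply' _ _ _
  have hj : StrictMono j := strictMono_nat_of_lt_succ fun n => by
    rw [hj_succ]
    exact hnext _
  have hcompact : IsCompactElement (⊤ : Opens K) := (Opens.isCompactElement_iff _).2 isCompact_univ
  obtain ⟨n, hn⟩ := (eventually_map_eq_top_of_liminf_eq_top
    (liminf_sup_exterior_ι_eq_top hc hι hj fun n => hN (j n)) g hcompact).exists
  rw [hj_succ] at hn
  exact hgN _ hn

end Compact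

section Small

lemma IsSeparatedInclusion.exists_lift {f : X ⟶ Y} (hf : IsSeparatedInclusion f) (g : Z ⟶ Y)
    (hg : preimage g (exterior f) = ⊥) : ∃ h : Z ⟶ X, h ≫ f = g := by
  obtain ⟨χ, hχ⟩ := exists_frameHom_comp_eq (preimage f)
    hf.extendsDisjoint.preimage_surjective (preimage g) fun b b' h => by
      simpa [hg] using preimage_mono g (hf.le_sup_exterior h)
  exact ⟨ofPreimage χ, hom_ext hχ⟩

lemma isOmegaSmallRelativeTo_of_le {D : MorphismProperty Locale.{u}}
    (hD : D ≤ separatedInclusions) (K : TopCat.{u}) [CompactSpace K] :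
    IsOmegaSmallRelativeTo.{w} (topToLocale.obj K) D := by
  intro J _ _ _ _ _ F _ hF
  refine ⟨fun {c} hc => ⟨?_⟩⟩
  let h : separatedInclusions.TransfiniteCompositionOfShape J (c.ι.app ⊥) :=
    { F := F
      isoBot := Iso.refl _
      incl := c.ι
      isColimit := hc
      map_mem := fun j _ => hD _ (hF j) }
  have hι (j : J) : IsSeparatedInclusion (c.ι.app j) := h.mem_incl_app j
  refine Types.FilteredColimit.isColimitOf' _ _ (fun g => ?_) (fun i x y hxy => ?_)
  · obtain ⟨i, hi⟩ := exists_map_exterior_eq_bot (K := K) hc hι (preimage g)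
    obtain ⟨k, hk⟩ := (hι i).exists_lift g hi
    exact ⟨i, k, hk.symm⟩
  · have := mono_of_preimage_surjective (hι i).extendsDisjoint.preimage_surjective
    exact ⟨i, 𝟙 i, by rw [(cancel_mono (c.ι.app i)).1 hxy]⟩

lemma isOmegaSmallRelativeTo_cell {W : MorphismProperty Locale.{u}} (hW : W ≤ separatedInclusions)
    (K : TopCat.{u}) [CompactSpace K] :
    IsOmegaSmallRelativeTo.{w} (topToLocale.obj K) (cell.{w} W) :=
  isOmegaSmallRelativeTo_of_le (cell_le hW) K

end Small

end Locales

end LocaleCell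

theorem mainTheorem11_general (K : Type u) [TopologicalSpace K] [CompactSpace K] :
    IsOmegaSmallRelativeTo.{w} (topToLocale.obj (TopCat.of K)) (cell.{w} locI.{u}) ∧
      IsOmegaSmallRelativeTo.{w} (topToLocale.obj (TopCat.of K)) (cell.{w} locJ.{u}) :=
  ⟨LocaleCell.isOmegaSmallRelativeTo_cell LocaleCell.locI_le_separatedInclusions _,
    LocaleCell.isOmegaSmallRelativeTo_cell LocaleCell.locJ_le_separatedInclusions _⟩

theorem mainTheorem11 :
    (∀ (K : Type u) [TopologicalSpace K] [CompactSpace K] [T2Space K],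
      IsOmegaSmallRelativeTo.{u} (topToLocale.obj (TopCat.of K)) (cell.{u} locI.{u}) ∧
      IsOmegaSmallRelativeTo.{u} (topToLocale.obj (TopCat.of K)) (cell.{u} locJ.{u})) ∧
    (∀ n : ℕ,
      IsOmegaSmallRelativeTo.{u} (topToLocale.obj (cubeBoundaryTop.{u} n)) (cell.{u} locI.{u}) ∧
      IsOmegaSmallRelativeTo.{u} (topToLocale.obj (cubeTop.{u} n)) (cell.{u} locJ.{u})) :=
  ⟨fun K _ _ _ => mainTheorem11_general K,
    fun _ => ⟨(mainTheorem11_general _).1, (mainTheorem11_general _).2⟩⟩
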